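/- Fix an algebraic closure $\overline{\mathbb Q}$ of $\mathbb Q$ and let $h$ be the absolute logarithmic Weil height on $\overline{\mathbb Q}$. For $\gamma\in\mathbb R$ and $a\in\overline{\mathbb Q}$ put $h_\gamma(a)=[\mathbb Q(a):\mathbb Q]^{\gamma}\,h(a)$. For $A\subset\overline{\mathbb Q}$ let $\mu_A$ be the set of roots of unity in $A$ and, for $C>0$, let $N_\gamma(A,C)=\#\{a\in A : h_\gamma(a)<C\}$. Let $$I_N(A)=\{\gamma\in\mathbb R : N_\gamma(A,C)<\infty\text{ for all }C>0\},$$ $$I_B(A)=\{\gamma\in\mathbb R : N_\gamma(A\setminus\mu_A,C)<\infty\text{ for some }C>0\},$$ $$\mathrm{Nor}_\gamma(A)=\inf\{C>0 : N_\gamma(A,C)=\infty\}\in[0,\infty],\qquad \inf\emptyset=\infty.$$ **Theorem.** Let $0\le\gamma<1$ and $c>0$ be real numbers, and let $(p_i)_{i\ge1}$ and $(d_i)_{i\ge1}$ be strictly increasing sequences of prime numbers. Let $f(x)$ be one of the functions $\log x$, $c$ (constant), $1/\log x$, and assume that $$\exp\bigl(f(d_i)\,d_i^{1-\gamma}\bigr)\le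 p_i\le 2\exp\bigl(f(d_i)\,d_i^{1-\gamma}\bigr)\qquad\text{for all } i.$$ For each $i$ let $p_i^{1/d_i}\in\overline{\mathbb Q}$ be a $d_i$-th root of $p_i$ (any choice), and let $L=\mathbb Q(p_i^{1/d_i} : i\ge1)$. 1. If $f(x)=\log x$, then $I_N(L)=I_B(L)=[\gamma,\infty)$. 2. If $f(x)=c$, then $I_N(L)=(\gamma,\infty)\subsetneq[\gamma,\infty)=I_B(L)$ and $c/2\le\mathrm{Nor}_\gamma(L)\le c$. 3. If $f(x)=1/\log x$, then $I_N(L)=I_B(L)=(\gamma,\infty)$. -/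

import Mathlib

noncomputable section

/-- A fixed algebraic closure of the rational numbers. -/
abbrev QBar : Type := AlgebraicClosure ℚ

namespace QBar

/-- The degree `[ℚ(a) : ℚ]` of an algebraic number. -/
def deg (a : QBar) : ℕ := Module.finrank ℚ (IntermediateField.adjoin ℚ {a})

/-- The `γ`-weighted Weil height `deg(a)^γ * h(a)`, where `h` is the absolute logarithmic
Weil height. -/
def weightedHeight (γ : ℝ) (a : QBar) : ℝ :=
  (deg a : ℝ) ^ γ * NumberField.absLogHeight₁ a

/-- The number (possibly infinite) of elements of `A` of `γ`-weighted height less than `C`. -/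
def countBelow (γ : ℝ) (A : Set QBar) (C : ℝ) : ℕ∞ :=
  {a | a ∈ A ∧ weightedHeight γ a < C}.encard

/-- The set of roots of unity in `A`. -/
def rootsOfUnityIn (A : Set QBar) : Set QBar :=
  {a | a ∈ A ∧ ∃ n : ℕ, 0 < n ∧ a ^ n = 1}

/-- The `γ`-Northcott property. -/
def HasNorthcott (γ : ℝ) (A : Set QBar) : Prop :=
  ∀ C : ℝ, 0 < C → countBelow γ A C < ⊤

/-- The `γ`-Bogomolov property. -/
def HasBogomolov (γ : ℝ) (A : Set QBar) : Prop :=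
  ∃ C : ℝ, 0 < C ∧ countBelow γ (A \ rootsOfUnityIn A) C < ⊤

/-- The `γ`-Northcott number, an extended real number (it is `⊤` when the set of `C` is empty). -/
def northcottNumber (γ : ℝ) (A : Set QBar) : EReal :=
  sInf ((fun C : ℝ => (C : EReal)) '' {C : ℝ | 0 < C ∧ countBelow γ A C = ⊤})

/-- The set of real `γ` such that `A` has the `γ`-Northcott property. -/
def northcottInterval (A : Set QBar) : Set ℝ := {γ | HasNorthcott γ A}

/-- The set of real `γ` such that `A` has the `γ`-Bogomolov property. -/
def bogomolovInterval (A : Set QBar) : Set ℝ := {γ | HasBogomolov γ A}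

end QBar

end

/-! Everything reduces to two estimates for the tower `L_n = ℚ(r_0, …, r_{n-1})`, whose union is
`L`. The generator `r_n` has degree `d_n` and height `log p_n / d_n`, so its `δ`-weighted height is
at most about `d_n^(δ-γ) f(d_n)`. Conversely, every element of `L_{n+1}` outside `L_n` has degree at
least `d_n` and, for `n` large and `δ ≥ 0`, `δ`-weighted height at least about half of that. By
Northcott's theorem each `L_n` contributes finitely many elements of bounded height, so the
behaviour of `x^(δ-γ) f(x)` at infinity decides all three cases; the factor one half is the gap
between `c/2` and `c`.

The lower bound (`absLogHeight₁_ge_of_mem_adjoin_of_notMem`) comes from ramification. Let `p = p_n`,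
`m = d_n`, and let `F` be the Galois closure of `L_{n+1}`. The subfield `unitRootField F p` is
unramified at `p` and `r_n` generates `F` over it, so its fixing group `H` has order `m`, is the
inertia group of every prime above `p`, and `r_n` is a uniformizer there
(`inertia_eq_fixingSubgroup`). A new element `a` has `m` distinct conjugates under `H`, pairwise
congruent modulo `r_n` in the ultrametric sense (`FinitePlace.apply_conj_sub_le`). The product
formula for their Vandermonde determinant (`one_le_of_forall_apply_sub_le`) gives `log p / (2m) -
log m! / (m(m-1)) ≤ h(a)`. -/

namespace NumberField

open Height Module

/-! ### Heights under extension of number fields, and the absolute height. -/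

section Extension

variable {K F : Type*} [Field K] [NumberField K] [Field F] [NumberField F]

/-- A product over infinite places, weighted by multiplicity, is a product over embeddings. -/
lemma prod_infinitePlace_pow_mult {M : Type*} [CommMonoid M] (g : (K → ℝ) → M) :
    ∏ v : InfinitePlace K, g v ^ v.mult = ∏ φ : K →+* ℂ, g fun x ↦ ‖φ x‖ := by
  classical
  rw [← Finset.prod_fiberwise Finset.univ InfinitePlace.mk fun φ : K →+* ℂ ↦ g fun x ↦ ‖φ x‖]
  refine Finset.prod_congr rfl fun w _ ↦ ?_
  rw [Finset.prod_congr rfl (g := fun _ ↦ g w), Finset.prod_const, InfinitePlace.card_filter_mk_eq]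
  intro φ hφ
  rw [← (Finset.mem_filter.mp hφ).2]
  rfl

/-- Every complex embedding of `K` has `[F : K]` extensions to `F`. -/
lemma prod_embeddings_comp_algebraMap [Algebra K F] {M : Type*} [CommMonoid M]
    (g : (K → ℂ) → M) :
    ∏ φ : F →+* ℂ, g (fun x ↦ φ (algebraMap K F x)) =
      (∏ ψ : K →+* ℂ, g ψ) ^ finrank K F := by
  rw [Fintype.prod_equiv (RingHom.equivRatAlgHom F ℂ)
      (fun φ : F →+* ℂ ↦ g fun x ↦ φ (algebraMap K F x))
      (fun φ : F →ₐ[ℚ] ℂ ↦ g fun x ↦ φ (algebraMap K F x)) fun _ ↦ rfl,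
    Fintype.prod_equiv (RingHom.equivRatAlgHom K ℂ) (fun ψ : K →+* ℂ ↦ g ψ) (fun ψ : K →ₐ[ℚ] ℂ ↦ g ψ) fun _ ↦ rfl]
  have : FiniteDimensional K F := FiniteDimensional.right ℚ K F
  have : Algebra.IsSeparable K F := Algebra.isSeparable_tower_top_of_isSeparable ℚ K F
  rw [Fintype.prod_equiv algHomEquivSigma
      (fun φ : F →ₐ[ℚ] ℂ ↦ g fun x ↦ φ (algebraMap K F x)) (fun σ ↦ g σ.1),
    ← Finset.univ_sigma_univ, Finset.prod_sigma, ← Finset.prod_pow]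
  · refine Finset.prod_congr rfl fun σ _ ↦ ?_
    let : Algebra K ℂ := σ.toRingHom.toAlgebra
    simp_rw [Finset.prod_const]
    congr
    exact AlgHom.card K F ℂ
  · intro σ
    congr

/-- The behaviour of the multiplicative height under extension of number fields. -/
theorem mulHeight₁_algebraMap [Algebra K F] (x : K) :
    mulHeight₁ (algebraMap K F x) = mulHeight₁ x ^ finrank K F := by
  obtain ⟨a, b, hb, rfl⟩ := IsFractionRing.div_surjective (𝓞 K) x
  have hb0 : b ≠ 0 := nonZeroDivisors.ne_zero hb
  have hinj := FaithfulSMul.algebraMap_injective (𝓞 K) (𝓞 F)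
  have hbF : algebraMap (𝓞 K) (𝓞 F) b ≠ 0 := by simpa using hb0
  have e (c : 𝓞 K) : algebraMap K F (algebraMap (𝓞 K) K c) =
      algebraMap (𝓞 F) F (algebraMap (𝓞 K) (𝓞 F) c) := rfl
  let u : Fin 2 → 𝓞 K := ![a, b]
  have hu : u ≠ 0 := fun h ↦ hb0 (congrFun h 1)
  have hu' : (fun i ↦ algebraMap (𝓞 K) (𝓞 F) (u i)) ≠ 0 := fun h ↦ hbF (congrFun h 1)
  have hK : ![algebraMap (𝓞 K) K a, algebraMap (𝓞 K) K b] = fun i ↦ algebraMap (𝓞 K) K (u i) := by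
    ext i; fin_cases i <;> rfl
  have hF : ![algebraMap K F (algebraMap (𝓞 K) K a), algebraMap K F (algebraMap (𝓞 K) K b)] =
      fun i ↦ algebraMap (𝓞 F) F (algebraMap (𝓞 K) (𝓞 F) (u i)) := by
    ext i; fin_cases i <;> rfl
  have hK0 : (fun i ↦ algebraMap (𝓞 K) K (u i)) ≠ 0 := fun h ↦ hb0 <| by
    simpa [u] using congrFun h 1
  have hF0 : (fun i ↦ algebraMap (𝓞 F) F (algebraMap (𝓞 K) (𝓞 F) (u i))) ≠ 0 := fun h ↦ hbF <| by
    simpa [u] using congrFun h 1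
  rw [map_div₀, mulHeight₁_div_eq_mulHeight, mulHeight₁_div_eq_mulHeight, hK, hF,
    mulHeight_eq hK0, mulHeight_eq hF0, mul_pow]
  congr 1
  · rw [prod_infinitePlace_pow_mult (fun v : K → ℝ ↦ ⨆ i, v (algebraMap (𝓞 K) K (u i))),
      prod_infinitePlace_pow_mult
        (fun v : F → ℝ ↦ ⨆ i, v (algebraMap (𝓞 F) F (algebraMap (𝓞 K) (𝓞 F) (u i)))),
      ← prod_embeddings_comp_algebraMap (F := F)
        (fun v : K → ℂ ↦ ⨆ i, ‖v (algebraMap (𝓞 K) K (u i))‖)]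
    rfl
  -- The finite part of the height of `a / b` is the inverse norm of the ideal `(a, b)`, and
  -- extending an ideal to `F` raises its norm to the power `[F : K]`.
  · have h₁ := absNorm_mul_finprod_finitePlace_eq_one hu
    have h₂ := absNorm_mul_finprod_finitePlace_eq_one hu'
    have h₃ : (Ideal.span (Set.range fun i ↦ algebraMap (𝓞 K) (𝓞 F) (u i))) =
        (Ideal.span (Set.range u)).map (algebraMap (𝓞 K) (𝓞 F)) := by
      rw [Ideal.map_span, ← Set.range_comp]
      rfl
    have h₄ : finrank (𝓞 K) (𝓞 F) = finrank K F :=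
      (IsFractionRing.finrank_eq (𝓞 K) K (𝓞 F) F).symm
    rw [h₃, Ideal.absNorm_algebraMap, h₄] at h₂
    rw [eq_comm, ← inv_inj, ← inv_pow, eq_inv_of_mul_eq_one_right h₁,
      eq_inv_of_mul_eq_one_right h₂]
    simp

/-- The behaviour of the logarithmic height under extension of number fields. -/
theorem logHeight₁_algebraMap [Algebra K F] (x : K) :
    logHeight₁ (algebraMap K F x) = finrank K F * logHeight₁ x := by
  rw [logHeight₁_eq_log_mulHeight₁, logHeight₁_eq_log_mulHeight₁, mulHeight₁_algebraMap,
    Real.log_pow]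

theorem mulHeight₁_algEquiv (τ : K ≃ₐ[ℚ] F) (x : K) : mulHeight₁ (τ x) = mulHeight₁ x := by
  let : Algebra K F := τ.toRingEquiv.toRingHom.toAlgebra
  have h : mulHeight₁ (τ x) = mulHeight₁ x ^ finrank K F := mulHeight₁_algebraMap (F := F) x
  have h1 : finrank K F = 1 := by
    have h2 := finrank_mul_finrank ℚ K F
    have h3 := τ.toLinearEquiv.finrank_eq
    have : 0 < finrank ℚ F := finrank_pos
    nlinarith
  rw [h, h1, pow_one]

theorem logHeight₁_natCast (n : ℕ) [NeZero n] :
    logHeight₁ (n : F) = finrank ℚ F * Real.log n := by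
  rw [← Rat.logHeight₁_natCast, ← logHeight₁_algebraMap]
  simp

end Extension

section Absolute

variable {E : Type*} [Field E] [CharZero E]

open IntermediateField

/-- The absolute height is defined inside `ℚ(x)`; this lets it be computed in any number field
containing `x`, in particular in a Galois closure. -/
theorem absLogHeight₁_coe (F : IntermediateField ℚ E) [FiniteDimensional ℚ F] (x : F) :
    haveI : NumberField F := {}
    absLogHeight₁ (x : E) = logHeight₁ x / finrank ℚ F := by
  have : NumberField F := {}
  have hx : IsIntegral ℚ (x : E) := (IsIntegral.of_finite ℚ x).map F.val
  have : FiniteDimensional ℚ ℚ⟮(x : E)⟯ := adjoin.finiteDimensional hx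
  have : NumberField ℚ⟮(x : E)⟯ := {}
  have hle : ℚ⟮(x : E)⟯ ≤ F := by simp
  let : Algebra ℚ⟮(x : E)⟯ F := (inclusion hle).toRingHom.toAlgebra
  have key : logHeight₁ x = finrank ℚ⟮(x : E)⟯ F * logHeight₁ (AdjoinSimple.gen ℚ (x : E)) :=
    logHeight₁_algebraMap (AdjoinSimple.gen ℚ (x : E))
  have hd : (finrank ℚ F : ℝ) = finrank ℚ ℚ⟮(x : E)⟯ * finrank ℚ⟮(x : E)⟯ F := by
    exact_mod_cast (finrank_mul_finrank ℚ ℚ⟮(x : E)⟯ F).symm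
  have h0 : (finrank ℚ F : ℝ) ≠ 0 := by exact_mod_cast finrank_pos.ne'
  rw [key, absLogHeight₁, absMulHeight₁, dif_pos hx, Real.log_rpow (mulHeight₁_pos _),
    ← logHeight₁_eq_log_mulHeight₁]
  rw [hd] at h0 ⊢
  have h1 := left_ne_zero_of_mul h0
  have h2 := right_ne_zero_of_mul h0
  field_simp

theorem absLogHeight₁_nonneg (x : E) : 0 ≤ absLogHeight₁ x := by
  rw [absLogHeight₁, absMulHeight₁]
  split_ifs with h
  · have : FiniteDimensional ℚ ℚ⟮x⟯ := adjoin.finiteDimensional h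
    have : NumberField ℚ⟮x⟯ := {}
    exact Real.log_nonneg (Real.one_le_rpow (one_le_mulHeight₁ _) (by positivity))
  · simp

/-- Northcott's theorem for the absolute height on a fixed number field. -/
theorem finite_absLogHeight₁_le (F : IntermediateField ℚ E) [FiniteDimensional ℚ F] (C : ℝ) :
    {x : E | x ∈ F ∧ absLogHeight₁ x ≤ C}.Finite := by
  have : NumberField F := {}
  refine ((Northcott.finite_le (h := logHeight₁ (K := F)) (C * finrank ℚ F)).image
    (fun x : F ↦ (x : E))).subset ?_
  rintro x ⟨hx, hC⟩
  refine ⟨⟨x, hx⟩, ?_, rfl⟩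
  rw [absLogHeight₁_coe F ⟨x, hx⟩, div_le_iff₀ (by exact_mod_cast finrank_pos)] at hC
  exact hC

theorem absLogHeight₁_of_pow_eq_natCast {x : E} {d n : ℕ} (hd : d ≠ 0) [NeZero n]
    (hx : x ^ d = n) : absLogHeight₁ x = Real.log n / d := by
  have hi : IsIntegral ℚ x := IsIntegral.of_pow (Nat.pos_of_ne_zero hd) <| by
    rw [hx]
    exact_mod_cast isIntegral_algebraMap (R := ℚ) (A := E) (x := n)
  have : FiniteDimensional ℚ ℚ⟮x⟯ := adjoin.finiteDimensional hi
  have : NumberField ℚ⟮x⟯ := {}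
  have h1 : (AdjoinSimple.gen ℚ x) ^ d = n := by
    apply Subtype.ext
    simpa using hx
  have h2 := logHeight₁_pow (AdjoinSimple.gen ℚ x) d
  rw [h1, logHeight₁_natCast] at h2
  have h3 := absLogHeight₁_coe ℚ⟮x⟯ (AdjoinSimple.gen ℚ x)
  rw [AdjoinSimple.coe_gen] at h3
  have h0 : (finrank ℚ ℚ⟮x⟯ : ℝ) ≠ 0 := by exact_mod_cast finrank_pos.ne'
  rw [h3]
  field_simp
  linarith

end Absolute

end NumberField

/-! ### Inertia at `p` and ultrametric distances between conjugates. -/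

namespace NumberField

open Height Module IsDedekindDomain

section FinitePlace

variable {F : Type*} [Field F] [NumberField F]

lemma FinitePlace.apply_eq_one_iff (w : FinitePlace F) (x : 𝓞 F) :
    w (x : F) = 1 ↔ x ∉ w.maximalIdeal.asIdeal := by
  rw [← norm_embedding_eq]
  exact norm_eq_one_iff_notMem F w.maximalIdeal x

lemma FinitePlace.apply_sub_le (w : FinitePlace F) (x y : F) : w (x - y) ≤ max (w x) (w y) := by
  rw [sub_eq_add_neg, ← map_neg_eq_map w y]
  exact FinitePlace.add_le w x (-y)

/-- An element of order one at a finite place is a uniformizer there. -/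
lemma FinitePlace.apply_le_of_notMem_sq (w : FinitePlace F) {x r : 𝓞 F}
    (hx : x ∈ w.maximalIdeal.asIdeal) (hr : r ∉ w.maximalIdeal.asIdeal ^ 2) :
    w (x : F) ≤ w (r : F) := by
  set v := w.maximalIdeal with hv
  rw [← norm_embedding_eq, ← norm_embedding_eq, norm_embedding_int, norm_embedding_int]
  have hmono := (WithZeroMulInt.toNNReal_strictMono
    (HeightOneSpectrum.one_lt_absNorm_nnreal v)).monotone
  refine NNReal.coe_le_coe.mpr (hmono ?_)
  have h1 : v.intValuation x ≤ WithZero.exp (-((1 : ℕ) : ℤ)) :=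
    (v.intValuation_le_pow_iff_mem x 1).mpr (by simpa using hx)
  have h2 : ¬ v.intValuation r ≤ WithZero.exp (-((2 : ℕ) : ℤ)) := fun h ↦
    hr ((v.intValuation_le_pow_iff_mem r 2).mp h)
  have hr0 : r ≠ 0 := fun h ↦ hr (h ▸ zero_mem _)
  refine h1.trans ?_
  rw [v.intValuation_if_neg hr0] at h2 ⊢
  rw [WithZero.exp_le_exp] at h2 ⊢
  omega

end FinitePlace

section Inertia

variable {F : Type*} [Field F] [NumberField F]

/-- An automorphism in the inertia group of a prime above `p` fixes all `d`-th roots of `q`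
when `p` divides neither `d` nor `q`. -/
lemma inertia_apply_eq_of_pow_eq {p d q : ℕ} (hd : ¬ p ∣ d) (hq : ¬ p ∣ q) (hp : p.Prime)
    {P : Ideal (𝓞 F)} [P.IsPrime] (hpP : (p : 𝓞 F) ∈ P) {τ : Gal(F/ℚ)} (hτ : τ ∈ P.inertia Gal(F/ℚ))
    {x : F} (hx : x ^ d = q) : τ x = x := by
  have hd0 : d ≠ 0 := by rintro rfl; simp at hd
  have hnat (n : ℕ) (hn : ¬ p ∣ n) : (n : 𝓞 F) ∉ P := fun h ↦ by
    have hc := (Nat.isCoprime_iff_coprime.mpr ((Nat.Prime.coprime_iff_not_dvd hp).mpr hn)).map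
      (Int.castRingHom (𝓞 F))
    obtain ⟨u, v, huv⟩ := hc
    refine Ideal.IsPrime.ne_top ‹_› ((Ideal.eq_top_iff_one P).mpr ?_)
    rw [← huv]
    simpa using P.add_mem (P.mul_mem_left u hpP) (P.mul_mem_left v h)
  have hxi : IsIntegral ℤ x := IsIntegral.of_pow (Nat.pos_of_ne_zero hd0) <| by
    rw [hx]; exact_mod_cast isIntegral_algebraMap (R := ℤ) (A := F) (x := q)
  obtain ⟨y, rfl⟩ : ∃ y : 𝓞 F, (y : F) = x := ⟨⟨x, hxi⟩, rfl⟩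
  have hy : y ^ d = (q : 𝓞 F) := by
    apply RingOfIntegers.coe_injective
    simpa using hx
  have hτy : τ • y - y ∈ P := hτ y
  have hτy' : (τ • y) ^ d = y ^ d := by
    rw [← smul_pow', hy]
    exact map_natCast (MulSemiringAction.toRingHom Gal(F/ℚ) (𝓞 F) τ) q
  have hyP : y ∉ P := fun h ↦ hnat q hq (hy ▸ Ideal.pow_mem_of_mem P h d (Nat.pos_of_ne_zero hd0))
  suffices τ • y = y by
    conv_rhs => rw [← this]
    rfl
  by_contra hne
  -- Cancelling `τy - y` from `(τy)^d - y^d = 0` leaves a geometric sum equal to zero. Modulo `P`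
  -- that sum is `d y^(d-1)`, and neither factor lies in `P`.
  have hsum : (∑ i ∈ Finset.range d, (τ • y) ^ i * y ^ (d - 1 - i)) = 0 := by
    have h := (Commute.all (τ • y) y).geom_sum₂_mul d
    rw [hτy', sub_self] at h
    exact (mul_eq_zero.mp h).resolve_right (sub_ne_zero.mpr hne)
  have hsum' : (∑ i ∈ Finset.range d, y ^ i * y ^ (d - 1 - i)) ∈ P := by
    rw [← Ideal.Quotient.eq_zero_iff_mem, ← map_zero (Ideal.Quotient.mk P), ← hsum]
    simp only [map_sum, map_mul, map_pow]
    rw [Ideal.Quotient.eq.mpr hτy]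
  rw [geom_sum₂_self] at hsum'
  rcases Ideal.IsPrime.mem_or_mem ‹_› hsum' with h | h
  · exact hnat d hd h
  · exact hyP (Ideal.IsPrime.mem_of_pow_mem ‹_› _ h)

variable (F) in
/-- The subfield generated by all `d`-th roots of natural numbers `q` with `p` dividing neither
`d` nor `q`. It is unramified at `p`. -/
def unitRootField (p : ℕ) : IntermediateField ℚ F :=
  IntermediateField.adjoin ℚ {x | ∃ d q : ℕ, ¬ p ∣ d ∧ ¬ p ∣ q ∧ x ^ d = q}

lemma inertia_le_fixingSubgroup {p : ℕ} (hp : p.Prime) {P : Ideal (𝓞 F)} [P.IsPrime]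
    (hpP : (p : 𝓞 F) ∈ P) : P.inertia Gal(F/ℚ) ≤ (unitRootField F p).fixingSubgroup := by
  intro τ hτ
  rw [IntermediateField.mem_fixingSubgroup_iff]
  intro x hx
  have hle : unitRootField F p ≤ IntermediateField.fixedField (Subgroup.zpowers τ) := by
    refine IntermediateField.adjoin_le_iff.mpr ?_
    rintro y ⟨d, q, hd, hq, hy⟩
    rintro ⟨σ, hσ⟩
    exact inertia_apply_eq_of_pow_eq hd hq hp hpP
      ((Subgroup.zpowers_le.mpr hτ) hσ) hy
  exact hle hx ⟨τ, Subgroup.mem_zpowers τ⟩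

/-- An element of `H` is determined by the image of `r`, which is one of at most `m` roots of `X^m -
p`. -/
lemma card_fixingSubgroup_le {p m : ℕ} (hm : m ≠ 0) {r : F} (hr : r ^ m = p)
    {H : Subgroup Gal(F/ℚ)} (hinj : ∀ τ ∈ H, τ r = r → τ = 1) : Nat.card H ≤ m := by
  classical
  let f : H → {x // x ∈ (Polynomial.nthRoots m (p : F)).toFinset} := fun τ ↦ ⟨τ.1 r, by
    rw [Multiset.mem_toFinset, Polynomial.mem_nthRoots (Nat.pos_of_ne_zero hm), ← map_pow, hr,
      map_natCast]⟩
  have hf : Function.Injective f := by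
    intro σ τ h
    have h' : σ.1 r = τ.1 r := congrArg Subtype.val h
    have := hinj (τ⁻¹ * σ).1 (τ⁻¹ * σ).2 (by
      simp only [Subgroup.coe_mul, Subgroup.coe_inv, AlgEquiv.mul_apply, h']
      exact AlgEquiv.symm_apply_apply _ _)
    have h2 : τ⁻¹ * σ = 1 := Subtype.ext this
    exact (inv_mul_eq_one.mp h2).symm
  calc Nat.card H ≤ Nat.card {x // x ∈ (Polynomial.nthRoots m (p : F)).toFinset} :=
        Nat.card_le_card_of_injective f hf
    _ ≤ m := by
        rw [Nat.card_eq_fintype_card, Fintype.card_coe]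
        exact (Multiset.toFinset_card_le _).trans (Polynomial.card_nthRoots m _)

variable [IsGalois ℚ F]

lemma card_inertia_eq_ramificationIdx' {p : ℕ} (hp : p.Prime) {P : Ideal (𝓞 F)} [P.IsPrime]
    (hpP : (p : 𝓞 F) ∈ P) :
    Nat.card (P.inertia Gal(F/ℚ)) = (Ideal.span {(p : ℤ)}).ramificationIdx' P := by
  have hpz : Prime (p : ℤ) := Nat.prime_iff_prime_int.mp hp
  have : (Ideal.span {(p : ℤ)}).IsPrime := (Ideal.span_singleton_prime hpz.ne_zero).mpr hpz
  have hne : Ideal.span {(p : ℤ)} ≠ ⊥ := by simpa using hp.ne_zero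
  have : (Ideal.span {(p : ℤ)}).IsMaximal := this.isMaximal hne
  have : P.LiesOver (Ideal.span {(p : ℤ)}) := by
    refine ⟨Ideal.IsMaximal.eq_of_le this ?_ ?_⟩
    · exact Ideal.IsPrime.ne_top inferInstance
    · rw [Ideal.span_singleton_le_iff_mem, Ideal.mem_comap]
      simpa using hpP
  have : Finite (ℤ ⧸ Ideal.span {(p : ℤ)}) := by
    have : NeZero p := ⟨hp.ne_zero⟩
    exact Finite.of_equiv _ (Int.quotientSpanNatEquivZMod p).symm.toEquiv
  rw [Ideal.card_inertia_eq_ramificationIdxIn (Ideal.span {(p : ℤ)}) P,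
    Ideal.ramificationIdxIn_eq_ramificationIdx _ P Gal(F/ℚ),
    Ideal.ramificationIdx'_eq_ramificationIdx _ _ hne]

/-- If the `m`-th root `r` of `p` generates `F` over a subfield unramified at `p`, then that
subfield is the inertia field of every prime above `p`, and `r` is a uniformizer. -/
lemma inertia_eq_fixingSubgroup {p m : ℕ} (hp : p.Prime) (hm : m ≠ 0) {r : 𝓞 F} (hr : r ^ m = p)
    (hinj : ∀ τ ∈ (unitRootField F p).fixingSubgroup, τ (r : F) = r → τ = 1)
    {P : Ideal (𝓞 F)} [P.IsPrime] (hpP : (p : 𝓞 F) ∈ P) :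
    P.inertia Gal(F/ℚ) = (unitRootField F p).fixingSubgroup ∧
      Nat.card (unitRootField F p).fixingSubgroup = m ∧ r ∉ P ^ 2 := by
  have hle := inertia_le_fixingSubgroup hp hpP
  have hH : Nat.card (unitRootField F p).fixingSubgroup ≤ m :=
    card_fixingSubgroup_le hm (r := (r : F)) (by rw [← map_pow, hr, map_natCast]) hinj
  have hI := card_inertia_eq_ramificationIdx' hp hpP
  have hIH : Nat.card (P.inertia Gal(F/ℚ)) ≤ Nat.card (unitRootField F p).fixingSubgroup :=
    Subgroup.card_le_of_le hle
  -- If `r ∈ P^k` then `p = r^m ∈ P^(mk)`, so the ramification index is at least `mk`. The case `k =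
  -- 1` closes the chain `m ≤ |I| ≤ |H| ≤ m`; the case `k = 2` would contradict it.
  have hpow (k : ℕ) (hk : r ∈ P ^ k) : m * k ≤ Nat.card (P.inertia Gal(F/ℚ)) := by
    rw [hI]
    by_contra! hlt
    have h1 : Ideal.map (algebraMap ℤ (𝓞 F)) (Ideal.span {(p : ℤ)}) ≤ P ^ (m * k) := by
      rw [Ideal.map_span, Set.image_singleton, Ideal.span_singleton_le_iff_mem, mul_comm, pow_mul]
      simpa [← hr] using Ideal.pow_mem_pow hk m
    have h2 : Ideal.map (algebraMap ℤ (𝓞 F)) (Ideal.span {(p : ℤ)}) ≠ ⊥ := by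
      rw [Ideal.map_span, Set.image_singleton, Ne, Ideal.span_singleton_eq_bot]
      simpa using hp.ne_zero
    have hP0 : P ≠ ⊥ := by
      rintro rfl
      rw [Ideal.mem_bot] at hpP
      exact hp.ne_zero (by exact_mod_cast hpP)
    rw [Ideal.IsDedekindDomain.ramificationIdx'_eq_multiplicity h2 inferInstance] at hlt
    have hfin : FiniteMultiplicity P (Ideal.map (algebraMap ℤ (𝓞 F)) (Ideal.span {(p : ℤ)})) :=
      FiniteMultiplicity.of_prime_left (Ideal.prime_of_isPrime hP0 inferInstance) h2
    exact hfin.not_pow_dvd_of_multiplicity_lt hlt (Ideal.dvd_iff_le.mpr h1)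
  have hrP : r ∈ P := Ideal.IsPrime.mem_of_pow_mem inferInstance m (hr ▸ hpP)
  have h1 := hpow 1 (by simpa using hrP)
  refine ⟨?_, by omega, fun h ↦ ?_⟩
  · exact Subgroup.eq_of_le_of_card_ge hle (by omega)
  · have h2 := hpow 2 h
    omega

/-- The ultrametric distance between conjugates under the inertia group. -/
lemma FinitePlace.apply_conj_sub_le {p m : ℕ} (hp : p.Prime) (hm : m ≠ 0) {r : F} (hr : r ^ m = p)
    (hinj : ∀ τ ∈ (unitRootField F p).fixingSubgroup, τ r = r → τ = 1) (w : FinitePlace F)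
    {τ : Gal(F/ℚ)} (hτ : τ ∈ (unitRootField F p).fixingSubgroup) (a : F) :
    w (τ a - a) ≤ w r * (max (w (τ a)) 1 * max (w a) 1) := by
  have hri : IsIntegral ℤ r := IsIntegral.of_pow (Nat.pos_of_ne_zero hm) <| by
    rw [hr]; exact_mod_cast isIntegral_algebraMap (R := ℤ) (A := F) (x := p)
  obtain ⟨s, rfl⟩ : ∃ y : 𝓞 F, (y : F) = r := ⟨⟨r, hri⟩, rfl⟩
  have hs : s ^ m = (p : 𝓞 F) := by
    apply RingOfIntegers.coe_injective
    simpa using hr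
  have hmax (x : F) : 1 ≤ max (w x) 1 := le_max_right _ _
  by_cases hpP : (p : 𝓞 F) ∈ w.maximalIdeal.asIdeal
  · obtain ⟨hI, -, hs2⟩ := inertia_eq_fixingSubgroup hp hm hs hinj hpP
    rw [← hI] at hτ
    have hin (x : 𝓞 F) : τ • x - x ∈ w.maximalIdeal.asIdeal := hτ x
    have hnum (n d : 𝓞 F) : w (τ n * d - n * τ d) ≤ w (s : F) := by
      have h : (τ • n - n) * d - n * (τ • d - d) ∈ w.maximalIdeal.asIdeal :=
        sub_mem (Ideal.mul_mem_right _ _ (hin n)) (Ideal.mul_mem_left _ _ (hin d))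
      convert FinitePlace.apply_le_of_notMem_sq w h hs2 using 2
      push_cast
      rw [AlgEquiv.smul_def, AlgEquiv.smul_def]
      ring
    -- Either `a = n/d` or `a = d/n` with `d` a unit at `w`. In the second case the estimate is
    -- applied to the inverse of `a`, and the factor `τa · a` that appears is absorbed by the two
    -- maxima.
    obtain ⟨n, ⟨d, hd⟩, h | h⟩ := w.maximalIdeal.exists_primeCompl_mul_eq_or_mul_eq a
    · have hd1 : w (d : F) = 1 := (FinitePlace.apply_eq_one_iff w d).mpr hd
      have hd2 : w (τ d) = 1 := (FinitePlace.apply_eq_one_iff w (τ • d)).mpr fun h ↦ hd <| by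
        simpa using sub_mem h (hin d)
      have e : (τ a - a) * (d * τ d) = τ n * d - n * τ d := by
        change a * (d : F) = (n : F) at h
        rw [← h, map_mul]; ring
      have h1 := hnum n d
      rw [← e, map_mul, map_mul, hd1, hd2, mul_one, mul_one] at h1
      refine h1.trans (le_mul_of_one_le_right (apply_nonneg w _) ?_)
      exact one_le_mul_of_one_le_of_one_le (hmax _) (hmax _)
    · change a * (n : F) = (d : F) at h
      have hd0 : (d : F) ≠ 0 := fun h0 ↦ hd <| by
        rw [RingOfIntegers.coe_injective (h0.trans (map_zero _).symm)]; exact zero_mem _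
      have hn0 : (n : F) ≠ 0 := right_ne_zero_of_mul (h ▸ hd0)
      have ha0 : a ≠ 0 := left_ne_zero_of_mul (h ▸ hd0)
      have hd1 : w (d : F) = 1 := (FinitePlace.apply_eq_one_iff w d).mpr hd
      have hd2 : w (τ d) = 1 := (FinitePlace.apply_eq_one_iff w (τ • d)).mpr fun h ↦ hd <| by
        simpa using sub_mem h (hin d)
      have e : (τ a - a) * (d * τ d) = (τ d * n - d * τ n) * (τ a * a) := by
        rw [← h, map_mul]; ring
      have h1 := congrArg w e
      rw [map_mul, map_mul w (d : F), hd1, hd2, mul_one, mul_one, map_mul] at h1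
      rw [h1, map_mul]
      gcongr
      · exact hnum d n
      · exact le_max_left _ _
      · exact le_max_left _ _
  -- Away from `p` the element `r` is a unit, and the plain ultrametric inequality suffices.
  · have hs1 : w (s : F) = 1 := (FinitePlace.apply_eq_one_iff w s).mpr fun h ↦ hpP <| by
      rw [← hs]; exact Ideal.pow_mem_of_mem _ h m (Nat.pos_of_ne_zero hm)
    rw [hs1, one_mul]
    refine (FinitePlace.apply_sub_le w _ _).trans (max_le ?_ ?_)
    · exact (le_max_left _ _).trans (le_mul_of_one_le_right (zero_le_one.trans (hmax _)) (hmax _))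
    · exact (le_max_left _ _).trans (le_mul_of_one_le_left (zero_le_one.trans (hmax _)) (hmax _))

end Inertia

end NumberField

/-! ### The product formula for a Vandermonde determinant of conjugates. -/

namespace NumberField

open Height Module

section Vandermonde

/-- Each index belongs to `m - 1` of the unordered pairs. -/
lemma prod_prod_Ioi_mul {M : Type*} [CommMonoid M] {m : ℕ} (f : Fin m → M) :
    ∏ i, ∏ j ∈ Finset.Ioi i, (f j * f i) = ∏ i, f i ^ (m - 1) := by
  simp_rw [Finset.prod_mul_distrib, Finset.prod_const, Fin.card_Ioi]
  rw [Finset.prod_comm' (t' := Finset.univ) (s' := fun j ↦ Finset.Iio j) (by simp)]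
  simp_rw [Finset.prod_const, Fin.card_Iio]
  rw [← Finset.prod_mul_distrib]
  refine Finset.prod_congr rfl fun i _ ↦ ?_
  rw [← pow_add]
  congr 1
  omega

lemma sum_card_Ioi_mul_two (m : ℕ) : (∑ i : Fin m, (Finset.Ioi i).card) * 2 = m * (m - 1) := by
  simp_rw [Fin.card_Ioi]
  rw [Fin.sum_univ_eq_sum_range (fun i ↦ m - 1 - i), Finset.sum_range_reflect (fun i ↦ i),
    Finset.sum_range_id_mul_two]

/-- The Leibniz expansion has `m!` terms. This is used at the infinite places and is the source of
the error term `log m!`. -/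
lemma abv_det_vandermonde_le {F : Type*} [Field F] (w : AbsoluteValue F ℝ) {m : ℕ}
    (v : Fin m → F) :
    w (Matrix.vandermonde v).det ≤ m.factorial * ∏ i, max (w (v i)) 1 ^ (m - 1) := by
  have hterm (σ : Equiv.Perm (Fin m)) :
      w (Equiv.Perm.sign σ • ∏ i, Matrix.vandermonde v (σ i) i) ≤
        ∏ i, max (w (v i)) 1 ^ (m - 1) := by
    have hs : w (Equiv.Perm.sign σ • ∏ i, Matrix.vandermonde v (σ i) i) =
        w (∏ i, Matrix.vandermonde v (σ i) i) := by
      rcases Int.units_eq_one_or (Equiv.Perm.sign σ) with h | h <;> simp [h]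
    rw [hs, map_prod, ← Equiv.prod_comp σ fun i ↦ max (w (v i)) 1 ^ (m - 1)]
    refine Finset.prod_le_prod (fun _ _ ↦ w.nonneg _) fun i _ ↦ ?_
    rw [Matrix.vandermonde_apply, map_pow]
    calc w (v (σ i)) ^ (i : ℕ) ≤ max (w (v (σ i))) 1 ^ (i : ℕ) :=
          pow_le_pow_left₀ (w.nonneg _) (le_max_left _ _) _
      _ ≤ max (w (v (σ i))) 1 ^ (m - 1) := pow_le_pow_right₀ (le_max_right _ _) (by omega)
  rw [Matrix.det_apply]
  refine (w.sum_le _ _).trans ((Finset.sum_le_sum fun σ _ ↦ hterm σ).trans (le_of_eq ?_))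
  rw [Finset.sum_const, nsmul_eq_mul, Finset.card_univ, Fintype.card_perm, Fintype.card_fin]

end Vandermonde

section LowerBound

/-- Solves the logarithm of the product formula inequality for the height: `D` is the degree of the
field, `N` the number of pairs of conjugates, and `P`, `R`, `f` are the logarithms of `p`, of the
finite product of `w r`, and of `m!`. -/
lemma sub_div_le_div_of_log_nonneg {D m N R P f h : ℝ} (hD : 0 < D) (hm : 0 < m) (hN : 0 < N)
    (hR : m * R = -(D * P)) (hlog : 0 ≤ D * f + N * R + N * 2 * h) :
    P / (2 * m) - f / (N * 2) ≤ h / D := by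
  obtain rfl : R = -(D * P) / m := by field_simp; linarith
  have h2 := div_nonneg hlog (by positivity : 0 ≤ N * 2 * D)
  have h3 : h / D - (P / (2 * m) - f / (N * 2)) =
      (D * f + N * (-(D * P) / m) + N * 2 * h) / (N * 2 * D) := by
    field_simp
    ring
  linarith

variable {F : Type*} [Field F] [NumberField F]

lemma finprod_finitePlace_pow_eq {p m : ℕ} (hp : p.Prime) (hm : m ≠ 0) {r : F} (hr : r ^ m = p) :
    (∏ᶠ w : FinitePlace F, w r) ^ m = ((p : ℝ) ^ finrank ℚ F)⁻¹ := by
  have hp0 : (p : F) ≠ 0 := by exact_mod_cast hp.ne_zero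
  have hr0 : r ≠ 0 := by rintro rfl; rw [zero_pow hm] at hr; exact hp0 hr.symm
  rw [finprod_pow (FinitePlace.hasFiniteMulSupport hr0)]
  simp_rw [← map_pow, hr]
  rw [FinitePlace.prod_eq_inv_abs_norm hp0]
  have h : Algebra.norm ℚ (p : F) = (p : ℚ) ^ finrank ℚ F := by
    simpa using Algebra.norm_algebraMap (S := F) (p : ℚ)
  rw [h]
  push_cast
  simp

/-- If the differences of a family of conjugates of `a` are all divisible by `r` at the finite
places, in the sense of ultrametric distances, then the product formula bounds the height of `a`
from below. -/
lemma one_le_of_forall_apply_sub_le {m : ℕ} {r a : F} (hr : r ≠ 0) {v : Fin m → F}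
    (hv : Function.Injective v) (hva : ∀ i, mulHeight₁ (v i) = mulHeight₁ a)
    (hle : ∀ (w : FinitePlace F) i j,
      w (v j - v i) ≤ w r * (max (w (v j)) 1 * max (w (v i)) 1)) :
    1 ≤ (m.factorial : ℝ) ^ finrank ℚ F *
      (∏ᶠ w : FinitePlace F, w r) ^ (∑ i : Fin m, (Finset.Ioi i).card) *
        mulHeight₁ a ^ (m * (m - 1)) := by
  set N := ∑ i : Fin m, (Finset.Ioi i).card with hN
  set V := (Matrix.vandermonde v).det with hV
  have hV0 : V ≠ 0 := Matrix.det_vandermonde_ne_zero_iff.mpr hv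
  have hsupp (i : Fin m) :
      (fun w : FinitePlace F ↦ max (w (v i)) 1 ^ (m - 1)).HasFiniteMulSupport := by
    refine Function.HasFiniteMulSupport.pow ?_ _
    rcases eq_or_ne (v i) 0 with h | h
    · simp [h, Function.HasFiniteMulSupport]
    · exact (FinitePlace.hasFiniteMulSupport h).max Function.hasFiniteMulSupport_fun_one
  have hsuppr : (fun w : FinitePlace F ↦ w r ^ N).HasFiniteMulSupport :=
    (FinitePlace.hasFiniteMulSupport hr).pow _
  have hsupp' :
      (fun w : FinitePlace F ↦ ∏ i, max (w (v i)) 1 ^ (m - 1)).HasFiniteMulSupport :=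
    Function.HasFiniteMulSupport.prod (fun i ↦ hsupp i) _
  have hfin : ∏ᶠ w : FinitePlace F, w V ≤
      (∏ᶠ w : FinitePlace F, w r) ^ N *
        ∏ i, (∏ᶠ w : FinitePlace F, max (w (v i)) 1) ^ (m - 1) := by
    have h1 : ∏ᶠ w : FinitePlace F, w V ≤
        ∏ᶠ w : FinitePlace F, w r ^ N * ∏ i, max (w (v i)) 1 ^ (m - 1) := by
      refine finprod_le_finprod (FinitePlace.hasFiniteMulSupport hV0) (fun _ ↦ apply_nonneg _ _)
        (hsuppr.mul hsupp') fun w ↦ ?_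
      -- One factor `w r` for each of the `N` pairs of conjugates, matching the factors of the
      -- determinant.
      have e : w r ^ N * ∏ i, max (w (v i)) 1 ^ (m - 1) =
          ∏ i, ∏ j ∈ Finset.Ioi i, w r * (max (w (v j)) 1 * max (w (v i)) 1) := by
        rw [← prod_prod_Ioi_mul, hN, ← Finset.prod_pow_eq_pow_sum, ← Finset.prod_mul_distrib]
        refine Finset.prod_congr rfl fun i _ ↦ ?_
        rw [← Finset.prod_const, ← Finset.prod_mul_distrib]
      rw [e, hV, Matrix.det_vandermonde, map_prod]
      refine Finset.prod_le_prod (fun _ _ ↦ apply_nonneg _ _) fun i _ ↦ ?_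
      rw [map_prod]
      exact Finset.prod_le_prod (fun _ _ ↦ apply_nonneg _ _) fun j _ ↦ hle w i j
    refine h1.trans (le_of_eq ?_)
    rw [finprod_mul_distrib hsuppr hsupp', ← finprod_pow (FinitePlace.hasFiniteMulSupport hr),
      finprod_prod_comm _ _ fun i _ ↦ hsupp i]
    congr 1
    refine Finset.prod_congr rfl fun i _ ↦ ?_
    rw [finprod_pow]
    rcases eq_or_ne (v i) 0 with h | h
    · simp [h, Function.HasFiniteMulSupport]
    · exact (FinitePlace.hasFiniteMulSupport h).max Function.hasFiniteMulSupport_fun_one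
  have hinf : ∏ w : InfinitePlace F, w V ^ w.mult ≤ (m.factorial : ℝ) ^ finrank ℚ F *
      ∏ i, (∏ w : InfinitePlace F, max (w (v i)) 1 ^ w.mult) ^ (m - 1) := by
    calc ∏ w : InfinitePlace F, w V ^ w.mult
        ≤ ∏ w : InfinitePlace F, (m.factorial * ∏ i, max (w (v i)) 1 ^ (m - 1)) ^ w.mult := by
          refine Finset.prod_le_prod (fun w _ ↦ pow_nonneg (apply_nonneg w _) _) fun w _ ↦ ?_
          exact pow_le_pow_left₀ (apply_nonneg w _) (abv_det_vandermonde_le w.1 v) _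
      _ = _ := by
          simp_rw [mul_pow, Finset.prod_mul_distrib, Finset.prod_pow_eq_pow_sum,
            InfinitePlace.sum_mult_eq, ← Finset.prod_pow]
          rw [Finset.prod_comm]
          simp_rw [← pow_mul, mul_comm]
  have hprod := prod_abs_eq_one hV0
  rw [← hprod]
  calc _ ≤ ((m.factorial : ℝ) ^ finrank ℚ F *
        ∏ i, (∏ w : InfinitePlace F, max (w (v i)) 1 ^ w.mult) ^ (m - 1)) *
        ((∏ᶠ w : FinitePlace F, w r) ^ N *
        ∏ i, (∏ᶠ w : FinitePlace F, max (w (v i)) 1) ^ (m - 1)) := by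
        refine mul_le_mul hinf hfin (finprod_nonneg fun w ↦ apply_nonneg w _) ?_
        refine mul_nonneg (by positivity) (Finset.prod_nonneg fun i _ ↦ pow_nonneg
          (Finset.prod_nonneg fun w _ ↦ by positivity) _)
    _ = (m.factorial : ℝ) ^ finrank ℚ F * (∏ᶠ w : FinitePlace F, w r) ^ N *
        ∏ i, mulHeight₁ (v i) ^ (m - 1) := by
        simp_rw [mulHeight₁_eq, mul_pow, Finset.prod_mul_distrib]
        ring
    _ = _ := by
        simp_rw [hva, Finset.prod_const, Finset.card_univ, Fintype.card_fin, ← pow_mul, mul_comm]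

variable [IsGalois ℚ F]

/-- A lower bound for the height of an element moved by the inertia group at `p`, when that group
has order `m` and `p` has an `m`-th root in `F`. -/
theorem le_logHeight₁_of_forall_ne {p m : ℕ} (hp : p.Prime) (hm : 2 ≤ m) {r : F}
    (hr : r ^ m = p) (hinj : ∀ τ ∈ (unitRootField F p).fixingSubgroup, τ r = r → τ = 1) {a : F}
    (hcard : Nat.card (unitRootField F p).fixingSubgroup = m)
    (ha : ∀ τ ∈ (unitRootField F p).fixingSubgroup, τ a = a → τ = 1) :
    Real.log p / (2 * m) - Real.log m.factorial / (m * (m - 1)) ≤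
      logHeight₁ a / finrank ℚ F := by
  have hm0 : m ≠ 0 := by omega
  have hp0 : (p : F) ≠ 0 := by exact_mod_cast hp.ne_zero
  have hr0 : r ≠ 0 := by rintro rfl; rw [zero_pow hm0] at hr; exact hp0 hr.symm
  set H := (unitRootField F p).fixingSubgroup
  let e : Fin m ≃ H := (Finite.equivFinOfCardEq hcard).symm
  have hdiff (i j : Fin m) : (e j).1 a = ((e j).1 * (e i).1⁻¹) ((e i).1 a) := by
    rw [AlgEquiv.mul_apply]
    congr 1
    exact (AlgEquiv.symm_apply_apply _ _).symm
  have hv : Function.Injective fun i ↦ (e i).1 a := by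
    intro i j hij
    have h1 : ((e j)⁻¹ * e i).1 = 1 := ha _ ((e j)⁻¹ * e i).2 (by
      change (e i).1 a = (e j).1 a at hij
      simp only [Subgroup.coe_mul, Subgroup.coe_inv, AlgEquiv.mul_apply, hij]
      exact AlgEquiv.symm_apply_apply _ _)
    exact e.injective (inv_mul_eq_one.mp (Subtype.ext h1)).symm
  have hmain := one_le_of_forall_apply_sub_le hr0 hv (fun i ↦ mulHeight₁_algEquiv (e i).1 a)
    fun w i j ↦ by
      have := FinitePlace.apply_conj_sub_le hp hm0 hr hinj w
        (H.mul_mem (e j).2 (H.inv_mem (e i).2)) ((e i).1 a)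
      rwa [← hdiff] at this
  have hR := finprod_finitePlace_pow_eq hp hm0 hr
  have hN := sum_card_Ioi_mul_two m
  set R := ∏ᶠ w : FinitePlace F, w r
  set N := ∑ i : Fin m, (Finset.Ioi i).card
  have hppos : (0 : ℝ) < p := by exact_mod_cast hp.pos
  have hRne : R ≠ 0 := by
    intro h
    rw [h, zero_pow hm0] at hR
    exact (inv_pos.mpr (pow_pos hppos (finrank ℚ F))).ne hR
  have hfac : (m.factorial : ℝ) ≠ 0 := by exact_mod_cast m.factorial_ne_zero
  have hH := mulHeight₁_ne_zero a
  have hlog := Real.log_nonneg hmain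
  rw [Real.log_mul (by positivity) (by positivity), Real.log_mul (by positivity) (by positivity),
    Real.log_pow, Real.log_pow, Real.log_pow, ← logHeight₁_eq_log_mulHeight₁] at hlog
  have hR' := congrArg Real.log hR
  rw [Real.log_pow, Real.log_inv, Real.log_pow] at hR'
  have hN' : (N : ℝ) * 2 = m * (m - 1) := by
    have h := congrArg (Nat.cast : ℕ → ℝ) hN
    rwa [Nat.cast_mul, Nat.cast_mul, Nat.cast_sub (by omega), Nat.cast_one, Nat.cast_two] at h
  have hc : ((m * (m - 1) : ℕ) : ℝ) = N * 2 := by exact_mod_cast hN.symm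
  rw [hc] at hlog
  rw [← hN']
  have hD : (0 : ℝ) < finrank ℚ F := by exact_mod_cast finrank_pos
  have hm2 : (2 : ℝ) ≤ m := by exact_mod_cast hm
  have hNpos : (0 : ℝ) < N := by nlinarith
  have hmpos : (0 : ℝ) < m := by linarith
  exact sub_div_le_div_of_log_nonneg hD hmpos hNpos hR' hlog

end LowerBound

end NumberField

/-! ### Galois theory of the radical tower. -/

namespace NumberField

open Height Module IntermediateField

section Galois

variable {F : Type*} [Field F] [NumberField F]

lemma mem_unitRootField {p d q : ℕ} (hd : ¬ p ∣ d) (hq : ¬ p ∣ q) {x : F} (hx : x ^ d = q) :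
    x ∈ unitRootField F p :=
  subset_adjoin ℚ _ ⟨d, q, hd, hq, hx⟩

/-- The quotient `r / s` is an `m`-th root of unity, hence a generator with `q = 1`. -/
lemma mem_unitRootField_of_pow_eq {p m : ℕ} (hp : p.Prime) (hpm : ¬ p ∣ m) {r s : F} (hs : s ≠ 0)
    (hrs : r ^ m = s ^ m) (hsU : s ∈ unitRootField F p) : r ∈ unitRootField F p := by
  have h : r / s ∈ unitRootField F p := by
    refine mem_unitRootField hpm (q := 1) hp.not_dvd_one ?_
    rw [div_pow, hrs, Nat.cast_one, div_self (pow_ne_zero m hs)]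
  rw [← div_mul_cancel₀ r hs]
  exact mul_mem h hsU

variable [IsGalois ℚ F]

lemma card_fixingSubgroup_unitRootField {p m : ℕ} (hp : p.Prime) (hm : m ≠ 0) {r : F}
    (hr : r ^ m = p) (hinj : ∀ τ ∈ (unitRootField F p).fixingSubgroup, τ r = r → τ = 1) :
    Nat.card (unitRootField F p).fixingSubgroup = m := by
  have hri : IsIntegral ℤ r := IsIntegral.of_pow (Nat.pos_of_ne_zero hm) <| by
    rw [hr]; exact_mod_cast isIntegral_algebraMap (R := ℤ) (A := F) (x := p)
  obtain ⟨s, rfl⟩ : ∃ y : 𝓞 F, (y : F) = r := ⟨⟨r, hri⟩, rfl⟩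
  have hs : s ^ m = (p : 𝓞 F) := by
    apply RingOfIntegers.coe_injective
    simpa using hr
  have hpz : Prime (p : ℤ) := Nat.prime_iff_prime_int.mp hp
  have : (Ideal.span {(p : ℤ)}).IsPrime := (Ideal.span_singleton_prime hpz.ne_zero).mpr hpz
  obtain ⟨P, hP, hPo⟩ := (inferInstance : Nonempty ((Ideal.span {(p : ℤ)}).primesOver (𝓞 F)))
  have hpP : (p : 𝓞 F) ∈ P := by
    have h : (p : ℤ) ∈ Ideal.comap (algebraMap ℤ (𝓞 F)) P := by
      rw [← Ideal.under_def, ← hPo.over]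
      exact Ideal.mem_span_singleton_self _
    simpa using h
  exact (inertia_eq_fixingSubgroup hp hm hs hinj hpP).2.1

/-- Adjoining an `m`-th root of a prime `p` to a field `ℚ(T)` unramified at `p`, the new elements
are moved by every nontrivial element of inertia. -/
lemma eq_one_of_apply_eq_of_notMem {p m : ℕ} (hp : p.Prime) (hm : m.Prime) (hpm : ¬ p ∣ m) {r : F}
    (hr : r ^ m = p) (hinj : ∀ τ ∈ (unitRootField F p).fixingSubgroup, τ r = r → τ = 1)
    {T : Set F} (hT : adjoin ℚ T ≤ unitRootField F p) {a : F} (ha : a ∈ adjoin ℚ (insert r T))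
    (ha' : a ∉ adjoin ℚ T) {τ : Gal(F/ℚ)} (hτ : τ ∈ (unitRootField F p).fixingSubgroup)
    (hτa : τ a = a) : τ = 1 := by
  have hcard := card_fixingSubgroup_unitRootField hp hm.ne_zero hr hinj
  have hp0 : (p : F) ≠ 0 := by exact_mod_cast hp.ne_zero
  by_contra hne
  set U := unitRootField F p
  set M := adjoin ℚ T
  have hrU : r ∉ U := fun h ↦ hne (hinj τ hτ (((IntermediateField.mem_fixingSubgroup_iff U τ).mp hτ) r h))
  -- The group has prime order `m`, so `τ ≠ 1` generates it; all of it then fixes `a`, and `a` lies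
  -- in `U`.
  have haU : a ∈ U := by
    have : Fact m.Prime := ⟨hm⟩
    have htop : Subgroup.zpowers (⟨τ, hτ⟩ : U.fixingSubgroup) = ⊤ :=
      zpowers_eq_top_of_prime_card hcard fun h ↦ hne (congrArg Subtype.val h)
    rw [← IsGalois.fixedField_fixingSubgroup U]
    rintro ⟨σ, hσ⟩
    obtain ⟨k, hk⟩ := Subgroup.mem_zpowers_iff.mp
      (htop.symm ▸ Subgroup.mem_top (⟨σ, hσ⟩ : U.fixingSubgroup))
    have hk' : τ ^ k = σ := by simpa using congrArg Subtype.val hk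
    have hmem : σ ∈ MulAction.stabilizer Gal(F/ℚ) a := by
      rw [← hk']
      exact Subgroup.zpow_mem _ (show τ • a = a from hτa) k
    exact hmem
  -- A root `s` of `X^m - p` in `M ≤ U` would differ from `r` by a root of unity in `U`, forcing `r
  -- ∈ U`.
  have hirr : Irreducible (Polynomial.X ^ m - Polynomial.C (p : M)) := by
    refine X_pow_sub_C_irreducible_of_prime hm fun s hs ↦ hrU ?_
    have hs' : (s : F) ^ m = p := by simpa using congrArg (fun x : M ↦ (x : F)) hs
    refine mem_unitRootField_of_pow_eq hp hpm (s := (s : F)) ?_ (hr.trans hs'.symm) (hT s.2)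
    intro h
    rw [h, zero_pow hm.ne_zero] at hs'
    exact hp0 hs'.symm
  have hri : IsIntegral M r := Algebra.IsIntegral.isIntegral r
  have hfr : finrank M M⟮r⟯ = m := by
    rw [adjoin.finrank hri, ← minpoly.eq_of_irreducible_of_monic hirr
      (by simp [hr]) (Polynomial.monic_X_pow_sub_C _ hm.ne_zero), Polynomial.natDegree_X_pow_sub_C]
  have har : a ∈ M⟮r⟯ := by
    have hle : adjoin ℚ (insert r T) ≤ M⟮r⟯.restrictScalars ℚ := by
      refine adjoin_le_iff.mpr (Set.insert_subset ?_ fun x hx ↦ ?_)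
      · exact mem_adjoin_simple_self M r
      · exact M⟮r⟯.algebraMap_mem ⟨x, subset_adjoin ℚ T hx⟩
    exact hle ha
  have hle : M⟮a⟯ ≤ M⟮r⟯ := by simpa using har
  -- Since `[M(r) : M] = m` is prime and `a ∉ M`, the fields `M(a)` and `M(r)` coincide; but `M(a) ≤
  -- U` while `r ∉ U`.
  have hdvd : finrank M M⟮a⟯ ∣ m := hfr ▸ finrank_dvd_of_le_right hle
  have hne1 : finrank M M⟮a⟯ ≠ 1 := by
    rw [Ne, finrank_adjoin_simple_eq_one_iff, mem_bot]
    rintro ⟨x, rfl⟩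
    exact ha' x.2
  have heq : M⟮a⟯ = M⟮r⟯ :=
    eq_of_le_of_finrank_eq hle (((Nat.dvd_prime hm).mp hdvd).resolve_left hne1 |>.trans hfr.symm)
  have hleU : M⟮a⟯ ≤ extendScalars hT := by
    rw [adjoin_simple_le_iff, mem_extendScalars]
    exact haU
  have : r ∈ M⟮a⟯ := heq ▸ mem_adjoin_simple_self M r
  exact hrU (hleU this)

/-- A finite orbit of Galois conjugates bounds the degree from below. -/
lemma card_le_finrank_adjoin {H : Subgroup Gal(F/ℚ)} {a : F} (ha : ∀ τ ∈ H, τ a = a → τ = 1) :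
    Nat.card H ≤ finrank ℚ ℚ⟮a⟯ := by
  have hi : IsIntegral ℚ a := Algebra.IsIntegral.isIntegral a
  have h0 := minpoly.ne_zero hi
  rw [adjoin.finrank hi]
  let f : H → (minpoly ℚ a).rootSet F := fun τ ↦ ⟨τ.1 a, by
    rw [Polynomial.mem_rootSet_of_ne h0]
    exact (Polynomial.aeval_algHom_apply (τ.1 : F →ₐ[ℚ] F) a _).trans (by simp)⟩
  have hf : Function.Injective f := by
    intro σ τ h
    have h' : σ.1 a = τ.1 a := congrArg Subtype.val h
    have h2 : τ⁻¹ * σ = 1 := Subtype.ext <| ha (τ⁻¹ * σ).1 (τ⁻¹ * σ).2 (by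
      simp only [Subgroup.coe_mul, Subgroup.coe_inv, AlgEquiv.mul_apply, h']
      exact AlgEquiv.symm_apply_apply _ _)
    exact (inv_mul_eq_one.mp h2).symm
  refine (Nat.card_le_card_of_injective f hf).trans ?_
  rw [Nat.card_coe_set_eq]
  exact Polynomial.ncard_rootSet_le _ _

end Galois

section RadicalTower

variable {E : Type*} [Field E] [CharZero E] [IsAlgClosed E]

lemma mem_rootSet_prod_X_pow_sub_C {A : Type*} [Field A] [Algebra ℚ A] {p d : ℕ → ℕ}
    (hd : ∀ i, d i ≠ 0) (n : ℕ) (x : A) :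
    x ∈ (∏ j ∈ Finset.range (n + 1),
      (Polynomial.X ^ d j - Polynomial.C (p j : ℚ))).rootSet A ↔ ∃ j ≤ n, x ^ d j = p j := by
  have hQ0 : ∏ j ∈ Finset.range (n + 1), (Polynomial.X ^ d j - Polynomial.C (p j : ℚ)) ≠ 0 :=
    Finset.prod_ne_zero_iff.mpr fun j _ ↦ (Polynomial.monic_X_pow_sub_C _ (hd j)).ne_zero
  rw [Polynomial.mem_rootSet_of_ne hQ0, map_prod, Finset.prod_eq_zero_iff]
  simp [sub_eq_zero]

/-- Lower bounds for height and degree of the elements that appear in the `n`-th step of a tower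
generated by roots `r j` of primes `p j` of prime degrees `d j`. -/
theorem absLogHeight₁_ge_of_mem_adjoin_of_notMem {p d : ℕ → ℕ} (hp : ∀ i, (p i).Prime)
    (hd : ∀ i, (d i).Prime) {r : ℕ → E} (hr : ∀ i, r i ^ d i = (p i : E)) {n : ℕ}
    (hpn : ∀ j < n, p j ≠ p n) (hdn : ∀ j ≤ n, d j < p n) {a : E}
    (ha : a ∈ adjoin ℚ (r '' Set.Iio (n + 1))) (ha' : a ∉ adjoin ℚ (r '' Set.Iio n)) :
    Real.log (p n) / (2 * d n) - Real.log (d n).factorial / (d n * (d n - 1)) ≤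
      absLogHeight₁ a ∧ d n ≤ finrank ℚ ℚ⟮a⟯ := by
  classical
  let Q : Polynomial ℚ := ∏ j ∈ Finset.range (n + 1), (Polynomial.X ^ d j - Polynomial.C (p j : ℚ))
  have hd0 (j : ℕ) : d j ≠ 0 := (hd j).ne_zero
  let F : IntermediateField ℚ E := adjoin ℚ (Q.rootSet E)
  have hsplit : Q.IsSplittingField ℚ F :=
    adjoin_rootSet_isSplittingField (IsAlgClosed.splits _)
  have : FiniteDimensional ℚ F := Polynomial.IsSplittingField.finiteDimensional F Q
  have : NumberField F := {}
  have : Normal ℚ F := Normal.of_isSplittingField Q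
  have : IsGalois ℚ F := {}
  have hrF (j : ℕ) (hj : j ≤ n) : r j ∈ F := subset_adjoin ℚ _ ((mem_rootSet_prod_X_pow_sub_C hd0 n _).mpr ⟨j, hj, hr j⟩)
  let s : F := ⟨r n, hrF n le_rfl⟩
  have hs : s ^ d n = p n := Subtype.ext (by simpa [s] using hr n)
  have hs0 : s ≠ 0 := by
    intro h
    rw [h, zero_pow (hd n).ne_zero] at hs
    exact (hp n).ne_zero (by exact_mod_cast hs.symm)
  have hdvd (j : ℕ) (hj : j ≤ n) : ¬ p n ∣ d j := Nat.not_dvd_of_pos_of_lt (hd j).pos (hdn j hj)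
  have hunit (j : ℕ) (hj : j < n) (x : F) (hx : x ^ d j = p j) : x ∈ unitRootField F (p n) :=
    mem_unitRootField (hdvd j hj.le)
      (fun h ↦ hpn j hj ((Nat.prime_dvd_prime_iff_eq (hp n) (hp j)).mp h).symm) hx
  have hinj : ∀ τ ∈ (unitRootField F (p n)).fixingSubgroup, τ s = s → τ = 1 := by
    intro τ hτ hτs
    rw [IntermediateField.mem_fixingSubgroup_iff] at hτ
    have hext : (τ : F →ₐ[ℚ] F) = AlgHom.id ℚ F := by
      refine AlgHom.ext_of_adjoin_eq_top hsplit.adjoin_rootSet' fun x hx ↦ ?_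
      obtain ⟨j, hj, hx⟩ := (mem_rootSet_prod_X_pow_sub_C hd0 n x).mp hx
      change τ x = x
      -- Roots of the earlier factors already lie in the unramified field; roots of the last one are
      -- `s` times a root of unity in that field.
      rcases hj.lt_or_eq with hj | rfl
      · exact hτ x (hunit j hj x hx)
      · have h1 : x / s ∈ unitRootField F (p j) := by
          refine mem_unitRootField (hdvd j le_rfl) (q := 1) (hp j).not_dvd_one ?_
          rw [div_pow, hx, hs, Nat.cast_one, div_self]
          exact_mod_cast (hp j).ne_zero
        rw [← div_mul_cancel₀ x hs0, map_mul, hτ _ h1, hτs]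
    ext x
    exact congrArg Subtype.val (DFunLike.congr_fun hext x)
  let T : Set F := {x | ∃ j < n, r j = x}
  have hT : adjoin ℚ T ≤ unitRootField F (p n) := by
    refine adjoin_le_iff.mpr ?_
    rintro x ⟨j, hj, hx⟩
    exact hunit j hj x (Subtype.ext (by simpa [← hx] using hr j))
  have himT : F.val '' T = r '' Set.Iio n := by
    ext y
    constructor
    · rintro ⟨x, ⟨j, hj, hx⟩, rfl⟩
      exact ⟨j, hj, hx⟩
    · rintro ⟨j, hj, rfl⟩
      exact ⟨⟨r j, hrF j (Set.mem_Iio.mp hj).le⟩, ⟨j, hj, rfl⟩, rfl⟩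
  have himT' : F.val '' (insert s T) = r '' Set.Iio (n + 1) := by
    rw [Set.image_insert_eq, himT, show n + 1 = Order.succ n from rfl, Order.Iio_succ_eq_insert,
      Set.image_insert_eq]
    rfl
  rw [← himT', ← adjoin_map] at ha
  rw [← himT, ← adjoin_map] at ha'
  obtain ⟨b, hb, rfl⟩ := ha
  have hb' : b ∉ adjoin ℚ T := fun h ↦ ha' ⟨b, h, rfl⟩
  have hmain : ∀ τ ∈ (unitRootField F (p n)).fixingSubgroup, τ b = b → τ = 1 := fun τ hτ hτb ↦
    eq_one_of_apply_eq_of_notMem (hp n) (hd n) (hdvd n le_rfl) hs hinj hT hb hb' hτ hτb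
  have hcard := card_fixingSubgroup_unitRootField (hp n) (hd n).ne_zero hs hinj
  constructor
  · have := le_logHeight₁_of_forall_ne (hp n) (hd n).two_le hs hinj hcard hmain
    exact this.trans (absLogHeight₁_coe F b).ge
  · rw [← hcard]
    refine (card_le_finrank_adjoin hmain).trans (le_of_eq ?_)
    have hi : IsIntegral ℚ b := Algebra.IsIntegral.isIntegral b
    have hi' : IsIntegral ℚ (F.val b) := hi.map F.val
    refine Eq.trans ?_ (adjoin.finrank hi').symm
    rw [adjoin.finrank hi, minpoly.algHom_eq F.val F.val.injective]
    congr!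

end RadicalTower

end NumberField

/-! ### Counting elements of small weighted height in the tower. -/

namespace QBar

open NumberField IntermediateField Module Filter Topology

instance isAlgebraic : Algebra.IsAlgebraic ℚ QBar := by
  convert! AlgebraicClosure.isAlgebraic ℚ

lemma one_le_deg (a : QBar) : 1 ≤ deg a := by
  have : FiniteDimensional ℚ ℚ⟮a⟯ :=
    adjoin.finiteDimensional (Algebra.IsAlgebraic.isAlgebraic (R := ℚ) a).isIntegral
  exact finrank_pos

lemma absLogHeight₁_le_weightedHeight {γ : ℝ} (hγ : 0 ≤ γ) (a : QBar) :
    absLogHeight₁ a ≤ weightedHeight γ a :=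
  le_mul_of_one_le_left (absLogHeight₁_nonneg a)
    (Real.one_le_rpow (by exact_mod_cast one_le_deg a) hγ)

lemma HasNorthcott.hasBogomolov {γ : ℝ} {A : Set QBar} (h : HasNorthcott γ A) :
    HasBogomolov γ A := by
  refine ⟨1, one_pos, lt_of_le_of_lt (Set.encard_le_encard ?_) (h 1 one_pos)⟩
  exact fun _ ha ↦ ⟨ha.1.1, ha.2⟩

lemma countBelow_eq_top_of_diff {γ : ℝ} {A B : Set QBar} {C : ℝ}
    (h : countBelow γ (A \ B) C = ⊤) : countBelow γ A C = ⊤ := by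
  rw [eq_top_iff, ← h]
  exact Set.encard_le_encard fun _ ha ↦ ⟨ha.1.1, ha.2⟩

lemma deg_eq_of_pow_eq_prime {p d : ℕ} (hp : p.Prime) (hd : d.Prime) {r : QBar}
    (hr : r ^ d = p) : deg r = d := by
  have hirr : Irreducible (Polynomial.X ^ d - Polynomial.C (p : ℚ)) := by
    refine X_pow_sub_C_irreducible_of_prime hd fun b hb ↦ ?_
    have : Fact p.Prime := ⟨hp⟩
    have h := congrArg (padicValRat p) hb
    rw [padicValRat.pow, padicValRat.of_nat, padicValNat_self] at h
    exact hd.one_lt.ne' (Nat.dvd_one.mp (Int.natCast_dvd_natCast.mp ⟨_, h.symm⟩))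
  have hi : IsIntegral ℚ r := (Algebra.IsAlgebraic.isAlgebraic (R := ℚ) r).isIntegral
  rw [deg, adjoin.finrank hi, ← minpoly.eq_of_irreducible_of_monic hirr
      (by simp [hr]) (Polynomial.monic_X_pow_sub_C _ hd.ne_zero), Polynomial.natDegree_X_pow_sub_C]

lemma exists_mem_adjoin_image_Iio {r : ℕ → QBar} {a : QBar} (ha : a ∈ adjoin ℚ (Set.range r)) :
    ∃ n, a ∈ adjoin ℚ (r '' Set.Iio n) := by
  have hmono : Monotone fun n ↦ adjoin ℚ (r '' Set.Iio n) := fun m n h ↦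
    adjoin.mono ℚ _ _ (Set.image_mono (Set.Iio_subset_Iio h))
  have hle : adjoin ℚ (Set.range r) ≤ ⨆ n, adjoin ℚ (r '' Set.Iio n) := by
    refine adjoin_le_iff.mpr ?_
    rintro _ ⟨n, rfl⟩
    exact le_iSup (fun n ↦ adjoin ℚ (r '' Set.Iio n)) (n + 1)
      (subset_adjoin ℚ _ ⟨n, n.lt_succ_self, rfl⟩)
  have h := hle ha
  rw [← SetLike.mem_coe, coe_iSup_of_directed hmono.directed_le] at h
  exact Set.mem_iUnion.mp h

/-- Elements first appearing late in the tower have weighted height at least `C`; the others lie in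
a fixed number field, where Northcott's theorem applies. -/
lemma countBelow_lt_top_of_eventually_le {γ C : ℝ} (hγ : 0 ≤ γ) {r : ℕ → QBar}
    (h : ∀ᶠ n in atTop, ∀ a ∈ adjoin ℚ (r '' Set.Iio (n + 1)), a ∉ adjoin ℚ (r '' Set.Iio n) →
      C ≤ weightedHeight γ a) :
    countBelow γ (adjoin ℚ (Set.range r) : Set QBar) C < ⊤ := by
  obtain ⟨N, hN⟩ := eventually_atTop.mp h
  have hfd : FiniteDimensional ℚ (adjoin ℚ (r '' Set.Iio N)) := by
    have : Finite (r '' Set.Iio N) := ((Set.finite_Iio N).image r).to_subtype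
    exact finiteDimensional_adjoin fun x _ ↦
      (Algebra.IsAlgebraic.isAlgebraic (R := ℚ) x).isIntegral
  rw [countBelow, Set.encard_lt_top_iff]
  refine (finite_absLogHeight₁_le (adjoin ℚ (r '' Set.Iio N)) C).subset ?_
  rintro a ⟨ha, haC⟩
  refine ⟨?_, (absLogHeight₁_le_weightedHeight hγ a).trans haC.le⟩
  classical
  have hex := exists_mem_adjoin_image_Iio ha
  by_contra hnot
  -- The least level containing `a` is some `k + 1` with `k ≥ N`, so `a` is new at step `k`.
  have hlt : N < Nat.find hex := by
    by_contra! hle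
    exact hnot (adjoin.mono ℚ _ _ (Set.image_mono (Set.Iio_subset_Iio hle)) (Nat.find_spec hex))
  obtain ⟨k, hk⟩ := Nat.exists_eq_succ_of_ne_zero (Nat.ne_zero_of_lt hlt)
  refine haC.not_ge (hN k (by omega) a ?_ (Nat.find_min hex (by omega)))
  have := Nat.find_spec hex
  rwa [hk] at this

/-- The generators themselves are infinitely many distinct witnesses and not roots of unity, so they
can refute both the Northcott and the Bogomolov property. -/
lemma countBelow_diff_eq_top_of_eventually_lt {γ C : ℝ} {p d : ℕ → ℕ} (hp : ∀ i, (p i).Prime)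
    (hd : ∀ i, (d i).Prime) (hp_mono : StrictMono p) {r : ℕ → QBar}
    (hr : ∀ i, r i ^ d i = (p i : QBar)) (h : ∀ᶠ n in atTop, weightedHeight γ (r n) < C) :
    countBelow γ ((adjoin ℚ (Set.range r) : Set QBar) \
      rootsOfUnityIn (adjoin ℚ (Set.range r) : Set QBar)) C = ⊤ := by
  obtain ⟨N, hN⟩ := eventually_atTop.mp h
  have hinj : Function.Injective r := by
    intro i j hij
    have h1 : (p i : QBar) ^ d j = (p j : QBar) ^ d i := by
      rw [← hr, ← hr, hij, ← pow_mul, ← pow_mul, mul_comm]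
    have h2 : p i ^ d j = p j ^ d i := by exact_mod_cast h1
    have h3 : p i ∣ p j := (hp i).dvd_of_dvd_pow (h2 ▸ dvd_pow_self _ (hd j).ne_zero)
    exact hp_mono.injective ((Nat.prime_dvd_prime_iff_eq (hp i) (hp j)).mp h3)
  rw [countBelow, Set.encard_eq_top_iff]
  refine ((Set.Ici_infinite N).image hinj.injOn).mono ?_
  rintro _ ⟨n, hn, rfl⟩
  refine ⟨⟨subset_adjoin ℚ _ ⟨n, rfl⟩, ?_⟩, hN n hn⟩
  rintro ⟨-, k, hk, h1⟩
  have h2 : (p n : QBar) ^ k = 1 := by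
    rw [← hr, ← pow_mul, mul_comm, pow_mul, h1, one_pow]
  have h3 : p n ^ k = 1 := by exact_mod_cast h2
  exact (Nat.one_lt_pow hk.ne' (hp n).one_lt).ne' h3

section Growth

variable {γ : ℝ} {p d : ℕ → ℕ} {f : ℝ → ℝ} {r : ℕ → QBar}

lemma tendsto_natCast_comp (hd_mono : StrictMono d) :
    Tendsto (fun n ↦ (d n : ℝ)) atTop atTop :=
  tendsto_natCast_atTop_atTop.comp hd_mono.tendsto_atTop

/-- Combines `m! ≤ m^m` with `m ≤ 2(m - 1)`. -/
lemma log_factorial_div_le {m : ℕ} (hm : 2 ≤ m) :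
    Real.log m.factorial / (m * (m - 1)) ≤ 2 * Real.log m / m := by
  have hm2 : (2 : ℝ) ≤ m := by exact_mod_cast hm
  have h1 : Real.log m.factorial ≤ m * Real.log m := by
    rw [← Real.log_pow]
    exact Real.log_le_log (by exact_mod_cast m.factorial_pos)
      (by exact_mod_cast Nat.factorial_le_pow m)
  have h2 : 0 ≤ Real.log m := Real.log_nonneg (by linarith)
  rw [div_le_div_iff₀ (by nlinarith) (by linarith)]
  have h3 : Real.log m.factorial * m ≤ (m * Real.log m) * m := by gcongr
  have h4 : 0 ≤ m * Real.log m * (m - 2) := by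
    have : (0 : ℝ) ≤ m - 2 := by linarith
    positivity
  nlinarith

/-- The lower bound for the weighted heights of the new elements in each step of the tower. -/
lemma eventually_le_weightedHeight (hp : ∀ i, (p i).Prime) (hd : ∀ i, (d i).Prime)
    (hp_mono : StrictMono p) (hd_mono : StrictMono d)
    (hlower : ∀ i, Real.exp (f (d i) * (d i : ℝ) ^ (1 - γ)) ≤ (p i : ℝ))
    (hr : ∀ i, r i ^ d i = (p i : QBar))
    (hg : ∀ᶠ x in atTop, 0 < f x / 2 - 2 * (x ^ (γ - 1) * Real.log x)) {δ : ℝ} (hδ : 0 ≤ δ) :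
    ∀ᶠ n in atTop, ∀ a ∈ adjoin ℚ (r '' Set.Iio (n + 1)), a ∉ adjoin ℚ (r '' Set.Iio n) →
      (d n : ℝ) ^ (δ - γ) * (f (d n) / 2 - 2 * ((d n : ℝ) ^ (γ - 1) * Real.log (d n))) ≤
        weightedHeight δ a := by
  filter_upwards [(tendsto_natCast_comp hd_mono).eventually hg] with n hn a ha ha'
  have hx2 : (2 : ℝ) ≤ d n := by exact_mod_cast (hd n).two_le
  have hx0 : (0 : ℝ) < d n := by linarith
  have hlogp : f (d n) * (d n : ℝ) ^ (1 - γ) ≤ Real.log (p n) :=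
    (Real.le_log_iff_exp_le (by exact_mod_cast (hp n).pos)).mpr (hlower n)
  have hlog0 : 0 < Real.log (d n) := Real.log_pos (by linarith)
  have hinv : (d n : ℝ) ^ (γ - 1) * (d n : ℝ) ^ (1 - γ) = 1 := by
    rw [← Real.rpow_add hx0]; simp
  have hpos : 0 < (d n : ℝ) ^ (1 - γ) := Real.rpow_pos_of_pos hx0 _
  have hmul : (f (d n) / 2 - 2 * ((d n : ℝ) ^ (γ - 1) * Real.log (d n))) * (d n : ℝ) ^ (1 - γ) =
      f (d n) * (d n : ℝ) ^ (1 - γ) / 2 - 2 * Real.log (d n) := by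
    linear_combination (-2 * Real.log (d n)) * hinv
  -- Positivity of the bracket in `hg` gives `log p_n > 4 log d_n`. Hence `p_n` exceeds every `d_j`
  -- with `j ≤ n` and divides none of them.
  have hdp : d n < p n := by
    have h1 := mul_pos hn hpos
    rw [hmul] at h1
    have h2 : Real.log (d n) < Real.log (p n) := by linarith
    exact_mod_cast (Real.log_lt_log_iff hx0 (by exact_mod_cast (hp n).pos)).mp h2
  obtain ⟨hh, hdeg⟩ := absLogHeight₁_ge_of_mem_adjoin_of_notMem hp hd hr
    (fun j hj ↦ (hp_mono hj).ne) (fun j hj ↦ (hd_mono.monotone hj).trans_lt hdp) ha ha'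
  have hfac := log_factorial_div_le (hd n).two_le
  have hxδ : 0 < (d n : ℝ) ^ δ := Real.rpow_pos_of_pos hx0 _
  have e1 : (d n : ℝ) ^ (δ - γ) = (d n : ℝ) ^ δ * ((d n : ℝ) ^ (1 - γ) / d n) := by
    rw [← Real.rpow_sub_one hx0.ne', ← Real.rpow_add hx0]
    congr 1
    ring
  calc _ = (d n : ℝ) ^ δ *
        (f (d n) * (d n : ℝ) ^ (1 - γ) / (2 * d n) - 2 * Real.log (d n) / d n) := by
        rw [e1, mul_assoc, div_mul_eq_mul_div, mul_comm ((d n : ℝ) ^ (1 - γ)), hmul]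
        congr 1
        field_simp
    _ ≤ (d n : ℝ) ^ δ * absLogHeight₁ a := by
        gcongr
        refine le_trans ?_ hh
        gcongr
    _ ≤ weightedHeight δ a := by
        refine mul_le_mul_of_nonneg_right ?_ (absLogHeight₁_nonneg a)
        exact Real.rpow_le_rpow hx0.le (by exact_mod_cast hdeg) hδ

/-- The upper bound for the weighted heights of the generators. -/
lemma weightedHeight_le (hp : ∀ i, (p i).Prime) (hd : ∀ i, (d i).Prime)
    (hupper : ∀ i, (p i : ℝ) ≤ 2 * Real.exp (f (d i) * (d i : ℝ) ^ (1 - γ)))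
    (hr : ∀ i, r i ^ d i = (p i : QBar)) (δ : ℝ) (n : ℕ) :
    weightedHeight δ (r n) ≤
      (d n : ℝ) ^ (δ - γ) * f (d n) + Real.log 2 * (d n : ℝ) ^ (δ - 1) := by
  have hx0 : (0 : ℝ) < d n := by exact_mod_cast (hd n).pos
  have hp0 : (0 : ℝ) < p n := by exact_mod_cast (hp n).pos
  have : NeZero (p n) := ⟨(hp n).ne_zero⟩
  have hlogp : Real.log (p n) ≤ Real.log 2 + f (d n) * (d n : ℝ) ^ (1 - γ) := by
    refine (Real.log_le_log hp0 (hupper n)).trans (le_of_eq ?_)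
    rw [Real.log_mul two_ne_zero (Real.exp_ne_zero _), Real.log_exp]
  rw [weightedHeight, deg_eq_of_pow_eq_prime (hp n) (hd n) (hr n),
    absLogHeight₁_of_pow_eq_natCast (hd n).ne_zero (hr n)]
  have e1 : (d n : ℝ) ^ (δ - γ) = (d n : ℝ) ^ (δ - 1) * (d n : ℝ) ^ (1 - γ) := by
    rw [← Real.rpow_add hx0]
    congr 1
    ring
  calc (d n : ℝ) ^ δ * (Real.log (p n) / d n) = (d n : ℝ) ^ (δ - 1) * Real.log (p n) := by
        rw [Real.rpow_sub_one hx0.ne']; ring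
    _ ≤ (d n : ℝ) ^ (δ - 1) * (Real.log 2 + f (d n) * (d n : ℝ) ^ (1 - γ)) := by gcongr
    _ = _ := by rw [e1]; ring

end Growth

section Asymptotics

lemma tendsto_rpow_mul_log {s : ℝ} (hs : s < 0) :
    Tendsto (fun x : ℝ ↦ x ^ s * Real.log x) atTop (𝓝 0) := by
  refine ((isLittleO_log_rpow_atTop (neg_pos.mpr hs)).tendsto_div_nhds_zero).congr' ?_
  filter_upwards [eventually_gt_atTop 0] with x hx
  rw [Real.rpow_neg hx.le, div_inv_eq_mul, mul_comm]

lemma tendsto_rpow_mul_log_sq {s : ℝ} (hs : s < 0) :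
    Tendsto (fun x : ℝ ↦ x ^ s * Real.log x ^ 2) atTop (𝓝 0) := by
  have h := (tendsto_rpow_mul_log (s := s / 2) (by linarith)).pow 2
  rw [zero_pow two_ne_zero] at h
  refine h.congr' ?_
  filter_upwards [eventually_gt_atTop 0] with x hx
  rw [mul_pow, ← Real.rpow_natCast, ← Real.rpow_mul hx.le]
  norm_num

lemma tendsto_rpow_of_neg {s : ℝ} (hs : s < 0) : Tendsto (fun x : ℝ ↦ x ^ s) atTop (𝓝 0) := by
  simpa using tendsto_rpow_neg_atTop (neg_pos.mpr hs)

lemma tendsto_rpow_div_log {s : ℝ} (hs : 0 < s) :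
    Tendsto (fun x : ℝ ↦ x ^ s / Real.log x) atTop atTop := by
  have h : Tendsto (fun x : ℝ ↦ x ^ (-s) * Real.log x) atTop (𝓝[>] 0) := by
    refine tendsto_nhdsWithin_iff.mpr ⟨tendsto_rpow_mul_log (neg_neg_iff_pos.mpr hs), ?_⟩
    filter_upwards [eventually_gt_atTop 1] with x hx
    exact mul_pos (Real.rpow_pos_of_pos (by linarith) _) (Real.log_pos hx)
  refine h.inv_tendsto_nhdsGT_zero.congr' ?_
  filter_upwards [eventually_gt_atTop 0] with x hx
  rw [Pi.inv_apply, mul_inv, Real.rpow_neg hx.le, inv_inv, div_eq_mul_inv]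

lemma tendsto_lower_log {γ : ℝ} (hγ : γ < 1) :
    Tendsto (fun x : ℝ ↦ Real.log x / 2 - 2 * (x ^ (γ - 1) * Real.log x)) atTop atTop := by
  have h := ((tendsto_rpow_mul_log (sub_neg.mpr hγ)).const_mul 2).neg
  have h' := (Real.tendsto_log_atTop.atTop_div_const two_pos).atTop_add h
  exact h'.congr fun x ↦ by ring

lemma tendsto_lower_const {γ : ℝ} (hγ : γ < 1) (c : ℝ) :
    Tendsto (fun x : ℝ ↦ c / 2 - 2 * (x ^ (γ - 1) * Real.log x)) atTop (𝓝 (c / 2)) := by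
  simpa using ((tendsto_rpow_mul_log (sub_neg.mpr hγ)).const_mul 2).const_sub (c / 2)

lemma tendsto_mul_lower_inv_log {γ s : ℝ} (hγ : γ < 1) (hs : 0 < s) :
    Tendsto (fun x : ℝ ↦ x ^ s * (1 / Real.log x / 2 - 2 * (x ^ (γ - 1) * Real.log x)))
      atTop atTop := by
  have h : Tendsto (fun x : ℝ ↦ 1 / 2 - 2 * (x ^ (γ - 1) * Real.log x ^ 2)) atTop
      (𝓝 (1 / 2)) := by
    simpa using ((tendsto_rpow_mul_log_sq (sub_neg.mpr hγ)).const_mul 2).const_sub (1 / 2 : ℝ)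
  refine ((tendsto_rpow_div_log hs).atTop_mul_pos (by norm_num) h).congr' ?_
  filter_upwards [eventually_gt_atTop 1] with x hx
  have := (Real.log_pos hx).ne'
  field_simp

end Asymptotics

end QBar

/-! ### Comparison of the two bounds in the three cases. -/

namespace QBar

open Filter Topology

/-- The generators have weighted height tending to zero: the `log 2` term, due to the factor 2
allowed in the size of `p_i`, vanishes because `δ < 1`. -/
lemma not_hasBogomolov_of_tendsto {δ γ : ℝ} {A : Set QBar} {f : ℝ → ℝ} (hδ : δ < 1)
    (hU : ∀ C : ℝ, (∀ᶠ x : ℝ in atTop, x ^ (δ - γ) * f x + Real.log 2 * x ^ (δ - 1) < C) →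
      countBelow δ (A \ rootsOfUnityIn A) C = ⊤)
    (h : Tendsto (fun x : ℝ ↦ x ^ (δ - γ) * f x) atTop (𝓝 0)) : ¬ HasBogomolov δ A := by
  rintro ⟨C, hC, hlt⟩
  have h1 := h.add ((tendsto_rpow_of_neg (sub_neg.mpr hδ)).const_mul (Real.log 2))
  rw [mul_zero, add_zero] at h1
  exact hlt.ne (hU C (h1.eventually_lt_const hC))

end QBar

open Filter Topology QBar in
theorem theorem4p3 (γ c : ℝ) (hγ₀ : 0 ≤ γ) (hγ₁ : γ < 1) (hc : 0 < c)
    (p d : ℕ → ℕ) (hp : ∀ i, (p i).Prime) (hd : ∀ i, (d i).Prime)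
    (hp_mono : StrictMono p) (hd_mono : StrictMono d)
    (f : ℝ → ℝ)
    (hlower : ∀ i, Real.exp (f (d i) * (d i : ℝ) ^ (1 - γ)) ≤ (p i : ℝ))
    (hupper : ∀ i, (p i : ℝ) ≤ 2 * Real.exp (f (d i) * (d i : ℝ) ^ (1 - γ)))
    (r : ℕ → QBar) (hr : ∀ i, r i ^ d i = (p i : QBar))
    (L : IntermediateField ℚ QBar) (hL : L = IntermediateField.adjoin ℚ (Set.range r)) :
    ((∀ x, f x = Real.log x) →
      QBar.northcottInterval (L : Set QBar) = Set.Ici γ ∧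
      QBar.bogomolovInterval (L : Set QBar) = Set.Ici γ) ∧
    ((∀ x, f x = c) →
      QBar.northcottInterval (L : Set QBar) = Set.Ioi γ ∧
      Set.Ioi γ ⊂ Set.Ici γ ∧
      QBar.bogomolovInterval (L : Set QBar) = Set.Ici γ ∧
      ((c / 2 : ℝ) : EReal) ≤ QBar.northcottNumber γ (L : Set QBar) ∧
      QBar.northcottNumber γ (L : Set QBar) ≤ (c : EReal)) ∧
    ((∀ x, f x = 1 / Real.log x) →
      QBar.northcottInterval (L : Set QBar) = Set.Ioi γ ∧
      QBar.bogomolovInterval (L : Set QBar) = Set.Ioi γ) := by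

  subst hL
  set A : Set QBar := (IntermediateField.adjoin ℚ (Set.range r) : Set QBar) with hA
  have hlow (hg : ∀ᶠ x in atTop, 0 < f x / 2 - 2 * (x ^ (γ - 1) * Real.log x)) (δ C : ℝ)
      (hδ : 0 ≤ δ) (h : ∀ᶠ x : ℝ in atTop,
        C ≤ x ^ (δ - γ) * (f x / 2 - 2 * (x ^ (γ - 1) * Real.log x))) :
      countBelow δ A C < ⊤ := by
    refine countBelow_lt_top_of_eventually_le hδ ?_
    filter_upwards [eventually_le_weightedHeight hp hd hp_mono hd_mono hlower hr hg hδ,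
      (tendsto_natCast_comp hd_mono).eventually h] with n h1 h2 a ha ha'
    exact h2.trans (h1 a ha ha')
  -- This bound needs no sign condition on `δ`, so it also excludes negative exponents.
  have hup (δ C : ℝ) (h : ∀ᶠ x : ℝ in atTop,
      x ^ (δ - γ) * f x + Real.log 2 * x ^ (δ - 1) < C) :
      countBelow δ (A \ rootsOfUnityIn A) C = ⊤ := by
    refine countBelow_diff_eq_top_of_eventually_lt hp hd hp_mono hr ?_
    filter_upwards [(tendsto_natCast_comp hd_mono).eventually h] with n hn
    exact (weightedHeight_le hp hd hupper hr δ n).trans_lt hn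
  have hnorth (hg : ∀ᶠ x in atTop, 0 < f x / 2 - 2 * (x ^ (γ - 1) * Real.log x)) {δ : ℝ}
      (hδ : 0 ≤ δ) (h : Tendsto (fun x : ℝ ↦
        x ^ (δ - γ) * (f x / 2 - 2 * (x ^ (γ - 1) * Real.log x))) atTop atTop) :
      HasNorthcott δ A := fun C _ ↦ hlow hg δ C hδ (h.eventually_ge_atTop C)
  refine ⟨fun hf ↦ ?_, fun hf ↦ ?_, fun hf ↦ ?_⟩
  · obtain rfl : f = Real.log := funext hf
    have ht := tendsto_lower_log hγ₁
    have hN {δ : ℝ} (hδ : γ ≤ δ) : HasNorthcott δ A := by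
      refine hnorth (ht.eventually_gt_atTop 0) (hγ₀.trans hδ) (tendsto_atTop_mono' _ ?_ ht)
      filter_upwards [eventually_ge_atTop 1, ht.eventually_ge_atTop 0] with x hx hx'
      exact le_mul_of_one_le_left hx' (Real.one_le_rpow hx (by linarith))
    have hB {δ : ℝ} (hδ : δ < γ) : ¬ HasBogomolov δ A :=
      not_hasBogomolov_of_tendsto (by linarith) (hup δ) (tendsto_rpow_mul_log (by linarith))
    constructor
    · ext δ
      exact ⟨fun h ↦ not_lt.mp fun hδ ↦ hB hδ h.hasBogomolov, hN⟩
    · ext δ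
      exact ⟨fun h ↦ not_lt.mp fun hδ ↦ hB hδ h, fun h ↦ (hN h).hasBogomolov⟩
  · obtain rfl : f = fun _ ↦ c := funext hf
    have ht := tendsto_lower_const hγ₁ c
    have hg := ht.eventually_const_lt (half_pos hc)
    have hN {δ : ℝ} (hδ : γ < δ) : HasNorthcott δ A :=
      hnorth hg (hγ₀.trans hδ.le)
        ((tendsto_rpow_atTop (sub_pos.mpr hδ)).atTop_mul_pos (half_pos hc) ht)
    have hB {δ : ℝ} (hδ : δ < γ) : ¬ HasBogomolov δ A := by
      refine not_hasBogomolov_of_tendsto (f := fun _ ↦ c) (by linarith) (hup δ) ?_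
      simpa using (tendsto_rpow_of_neg (sub_neg.mpr hδ)).mul_const c
    have hfin {C : ℝ} (hC : C < c / 2) : countBelow γ A C < ⊤ := by
      refine hlow hg γ C hγ₀ ?_
      filter_upwards [ht.eventually_const_lt hC] with x hx
      simpa using hx.le
    have hinf {C : ℝ} (hC : c < C) : countBelow γ A C = ⊤ := by
      refine countBelow_eq_top_of_diff (hup γ C ?_)
      have h1 := ((tendsto_rpow_of_neg (sub_neg.mpr hγ₁)).const_mul (Real.log 2)).const_add c
      rw [mul_zero, add_zero] at h1
      filter_upwards [h1.eventually_lt_const hC] with x hx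
      simpa using hx
    have hBγ : HasBogomolov γ A := by
      -- Any positive constant below `c / 2` would do.
      refine ⟨c / 4, by positivity, lt_of_le_of_lt (Set.encard_le_encard ?_)
        (hfin (C := c / 4) (by linarith))⟩
      exact fun _ ha ↦ ⟨ha.1.1, ha.2⟩
    refine ⟨?_, ?_, ?_, ?_, ?_⟩
    · ext δ
      refine ⟨fun h ↦ Set.mem_Ioi.mpr (not_le.mp fun hδ ↦ ?_), hN⟩
      rcases hδ.lt_or_eq with hδ | rfl
      · exact hB hδ h.hasBogomolov
      · exact (h (c + 1) (by linarith)).ne (hinf (by linarith))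
    · exact Set.Ioi_ssubset_Ici_self
    · ext δ
      refine ⟨fun h ↦ not_lt.mp fun hδ ↦ hB hδ h, fun hδ ↦ ?_⟩
      rcases (Set.mem_Ici.mp hδ).lt_or_eq with hδ | rfl
      · exact (hN hδ).hasBogomolov
      · exact hBγ
    · refine le_sInf ?_
      rintro _ ⟨C, ⟨-, hC⟩, rfl⟩
      exact EReal.coe_le_coe_iff.mpr (not_lt.mp fun h ↦ (hfin h).ne hC)
    -- Every real `z > c` belongs to the set whose infimum is taken.
    · refine EReal.le_of_forall_lt_iff_le.mp fun z hz ↦ sInf_le ⟨z, ⟨?_, ?_⟩, rfl⟩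
      · exact hc.trans (EReal.coe_lt_coe_iff.mp hz)
      · exact hinf (EReal.coe_lt_coe_iff.mp hz)
  · obtain rfl : f = fun x ↦ 1 / Real.log x := funext hf
    have hg : ∀ᶠ x : ℝ in atTop, 0 < 1 / Real.log x / 2 - 2 * (x ^ (γ - 1) * Real.log x) := by
      -- The exponent 1 is arbitrary: the bracket is positive because its product with `x` tends to
      -- infinity.
      filter_upwards [(tendsto_mul_lower_inv_log hγ₁ one_pos).eventually_gt_atTop 0,
        eventually_gt_atTop 0] with x hx hx'
      exact (mul_pos_iff_of_pos_left (Real.rpow_pos_of_pos hx' 1)).mp hx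
    have hN {δ : ℝ} (hδ : γ < δ) : HasNorthcott δ A :=
      hnorth hg (hγ₀.trans hδ.le) (tendsto_mul_lower_inv_log hγ₁ (sub_pos.mpr hδ))
    have hB {δ : ℝ} (hδ : δ ≤ γ) : ¬ HasBogomolov δ A := by
      refine not_hasBogomolov_of_tendsto (f := fun x ↦ 1 / Real.log x) (by linarith) (hup δ) ?_
      have h1 : Tendsto (fun x : ℝ ↦ 1 / Real.log x) atTop (𝓝 0) :=
        Real.tendsto_log_atTop.const_div_atTop 1
      refine squeeze_zero' ?_ ?_ h1
      · filter_upwards [eventually_gt_atTop 1] with x hx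
        have := Real.log_pos hx
        positivity
      · filter_upwards [eventually_gt_atTop 1] with x hx
        have := Real.log_pos hx
        exact mul_le_of_le_one_left (by positivity)
          (Real.rpow_le_one_of_one_le_of_nonpos hx.le (by linarith))
    constructor
    · ext δ
      exact ⟨fun h ↦ not_le.mp fun hδ ↦ hB hδ h.hasBogomolov, hN⟩
    · ext δ
      exact ⟨fun h ↦ not_le.mp fun hδ ↦ hB hδ h, fun h ↦ (hN h).hasBogomolov⟩
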